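/- For integers $n\ge 0$ and $m\ge 1$ let $H_n^{(m)}=\sum_{0<j\le n} \frac{1}{j^m}$ and $H_n=H_n^{(1)}$, and let $\zeta$ denote the Riemann zeta function. Then both of the following series converge absolutely, and $$\sum_{k=1}^\infty \frac{(-1)^k}{k^2\binom{2k}{k}\binom{3k}{k}}\left(\frac{7k-2}{2k-1}\,\bigl(2H_{2k-1}-H_{k-1}\bigr)+\frac1k\right)=-\frac32\,\zeta(3)$$ and $$\sum_{k=1}^\infty \frac{(-1)^k}{k^2\binom{2k}{k}\binom{3k}{k}}\left(\frac{7k-2}{2k-1}\,H_{k-1}^{(2)}-\frac{3}{4k^2}\right)=\frac{\pi^4}{720}.$$ -/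

import Mathlib

/-- The generalized harmonic number of order `m`: the sum of `1 / j ^ m` over `0 < j ≤ n`. -/
def genHarmonic (m n : ℕ) : ℚ := ∑ j ∈ Finset.Icc 1 n, 1 / (j : ℚ) ^ m

open Finset Filter Topology

/-! The proof uses Wilf–Zeilberger pairs. With G = `kernel * cert0`, the function F = `kernel`
satisfies F(n,k+1) - F(n,k) = G(n+1,k) - G(n,k). Perturbing this pair to first order in one
direction and to second order in another multiplies F by `logB` and by `logA ^ 2 - powSum 2 (n +
k)`, and G changes accordingly (`pairB_spec`, `pairA_spec`).

Summing over n and then over k gives ∑ₖ G(0,k) = ∑ₙ F(n,0), by `hasSum_of_pair`: the kernel is at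
most 4^(-k)/(n+1)^2, while the other factors grow polynomially in k and at most linearly in n. The
side n = 0 is twice the required series (`pairGB_zero_left`, `pairGA_zero_left`). The side k = 0 is
-3ζ(3), respectively 3ζ(4)/2 - ζ(2)²/2 = π⁴/360. -/

/-- The real generalized harmonic number of order `m`. -/
noncomputable def powSum (m n : ℕ) : ℝ := ∑ j ∈ range n, 1 / ((j : ℝ) + 1) ^ m

lemma powSum_zero (m : ℕ) : powSum m 0 = 0 := by simp [powSum]

lemma powSum_succ (m n : ℕ) : powSum m (n + 1) = powSum m n + 1 / ((n : ℝ) + 1) ^ m := by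
  simp [powSum, sum_range_succ]

/-! ### The kernel and its shift quotients -/

/-- The hypergeometric kernel of the Wilf–Zeilberger pairs. -/
noncomputable def kernel (n k : ℕ) : ℝ :=
  (-1) ^ k * (k.factorial : ℝ) ^ 2 * ((2 * k).factorial : ℝ) ^ 2 * n.factorial * (n + k).factorial /
    ((3 * k).factorial * ((n + 2 * k + 1).factorial : ℝ) ^ 2)

/-- The quotient `kernel n (k + 1) / kernel n k`. -/
noncomputable def ratioK (n k : ℝ) : ℝ :=
  -((k + 1) ^ 2 * (2 * k + 1) ^ 2 * (2 * k + 2) ^ 2 * (n + k + 1)) /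
    ((3 * k + 1) * (3 * k + 2) * (3 * k + 3) * (n + 2 * k + 2) ^ 2 * (n + 2 * k + 3) ^ 2)

/-- The quotient `kernel (n + 1) k / kernel n k`. -/
noncomputable def ratioN (n k : ℝ) : ℝ := (n + 1) * (n + k + 1) / (n + 2 * k + 2) ^ 2

lemma kernel_succ_right (n k : ℕ) : kernel n (k + 1) = kernel n k * ratioK n k := by
  have e1 : 2 * (k + 1) = 2 * k + 1 + 1 := by ring
  have e2 : 3 * (k + 1) = 3 * k + 1 + 1 + 1 := by ring
  have e3 : n + (2 * k + 1 + 1) + 1 = n + 2 * k + 1 + 1 + 1 := by ring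
  have e4 : n + (k + 1) = n + k + 1 := by ring
  rw [kernel, kernel, ratioK, e1, e2, e3, e4]
  simp only [Nat.factorial_succ (k), Nat.factorial_succ (2 * k), Nat.factorial_succ (2 * k + 1),
    Nat.factorial_succ (3 * k), Nat.factorial_succ (3 * k + 1), Nat.factorial_succ (3 * k + 1 + 1),
    Nat.factorial_succ (n + k), Nat.factorial_succ (n + 2 * k + 1),
    Nat.factorial_succ (n + 2 * k + 1 + 1)]
  have := Nat.factorial_ne_zero k
  have := Nat.factorial_ne_zero (2 * k)
  have := Nat.factorial_ne_zero (3 * k)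
  have := Nat.factorial_ne_zero n
  have := Nat.factorial_ne_zero (n + k)
  have := Nat.factorial_ne_zero (n + 2 * k + 1)
  push_cast
  field_simp
  ring

lemma kernel_succ_left (n k : ℕ) : kernel (n + 1) k = kernel n k * ratioN n k := by
  have e3 : n + 1 + 2 * k + 1 = n + 2 * k + 1 + 1 := by ring
  have e4 : n + 1 + k = n + k + 1 := by ring
  rw [kernel, kernel, ratioN, e3, e4]
  simp only [Nat.factorial_succ n, Nat.factorial_succ (n + k), Nat.factorial_succ (n + 2 * k + 1)]
  have := Nat.factorial_ne_zero (3 * k)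
  have := Nat.factorial_ne_zero (n + 2 * k + 1)
  push_cast
  field_simp
  ring

lemma kernel_zero_right (n : ℕ) : kernel n 0 = 1 / ((n : ℝ) + 1) ^ 2 := by
  have := Nat.factorial_ne_zero n
  simp only [kernel, mul_zero, add_zero, Nat.factorial_succ, Nat.factorial_zero]
  push_cast
  field_simp

/-! ### Harmonic factors -/

/-- Logarithmic derivative of the kernel in the direction used for `ζ(4)`. -/
noncomputable def logA (n k : ℕ) : ℝ :=
  powSum 1 k - powSum 1 (n + k) - powSum 1 (2 * k) + powSum 1 (n + 2 * k + 1)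

/-- Logarithmic derivative of the kernel in the direction used for `ζ(3)`. -/
noncomputable def logB (n k : ℕ) : ℝ :=
  powSum 1 n + 2 * powSum 1 (n + k) - 3 * powSum 1 (n + 2 * k + 1) - powSum 1 k + powSum 1 (2 * k)

/-- The increment of `logA` in `k`. -/
noncomputable def stepA (n k : ℝ) : ℝ :=
  1 / (k + 1) - 1 / (n + k + 1) - 1 / (2 * k + 1) - 1 / (2 * k + 2) + 1 / (n + 2 * k + 2) +
    1 / (n + 2 * k + 3)

/-- The increment of `logB` in `k`. -/
noncomputable def stepB (n k : ℝ) : ℝ :=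
  2 / (n + k + 1) - 3 / (n + 2 * k + 2) - 3 / (n + 2 * k + 3) - 1 / (k + 1) + 1 / (2 * k + 1) +
    1 / (2 * k + 2)

lemma logA_succ_right (n k : ℕ) : logA n (k + 1) = logA n k + stepA n k := by
  have e1 : 2 * (k + 1) = 2 * k + 1 + 1 := by ring
  have e3 : n + (2 * k + 1 + 1) + 1 = n + 2 * k + 1 + 1 + 1 := by ring
  have e4 : n + (k + 1) = n + k + 1 := by ring
  rw [logA, logA, stepA, e1, e3, e4]
  simp only [powSum_succ]
  push_cast
  ring

lemma logA_succ_left (n k : ℕ) :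
    logA (n + 1) k = logA n k + (1 / ((n : ℝ) + 2 * k + 2) - 1 / (n + k + 1)) := by
  have e3 : n + 1 + 2 * k + 1 = n + 2 * k + 1 + 1 := by ring
  have e4 : n + 1 + k = n + k + 1 := by ring
  rw [logA, logA, e3, e4]
  simp only [powSum_succ]
  push_cast
  ring

lemma logB_succ_right (n k : ℕ) : logB n (k + 1) = logB n k + stepB n k := by
  have e1 : 2 * (k + 1) = 2 * k + 1 + 1 := by ring
  have e3 : n + (2 * k + 1 + 1) + 1 = n + 2 * k + 1 + 1 + 1 := by ring
  have e4 : n + (k + 1) = n + k + 1 := by ring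
  rw [logB, logB, stepB, e1, e3, e4]
  simp only [powSum_succ]
  push_cast
  ring

lemma logB_succ_left (n k : ℕ) :
    logB (n + 1) k =
      logB n k + (1 / ((n : ℝ) + 1) + 2 / (n + k + 1) - 3 / (n + 2 * k + 2)) := by
  have e3 : n + 1 + 2 * k + 1 = n + 2 * k + 1 + 1 := by ring
  have e4 : n + 1 + k = n + k + 1 := by ring
  rw [logB, logB, e3, e4]
  simp only [powSum_succ]
  push_cast
  ring

/-! ### Rational certificates -/

def poly0 (n k : ℝ) : ℝ :=
  (40 + 256 * k + 640 * k^2 + 784 * k^3 + 472 * k^4 + 112 * k^5) +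
    n * (61 + 306 * k + 565 * k^2 + 456 * k^3 + 136 * k^4) +
    n^2 * (33 + 123 * k + 150 * k^2 + 60 * k^3) + n^3 * (6 + 15 * k + 9 * k^2)

def polyS (n k : ℝ) : ℝ :=
  (62 + 292 * k + 510 * k^2 + 392 * k^3 + 112 * k^4) +
    n * (66 + 232 * k + 270 * k^2 + 104 * k^3) + n^2 * (18 + 42 * k + 24 * k^2)

def polyM (n k : ℝ) : ℝ :=
  (9 + 37 * k + 52 * k^2 + 24 * k^3) + n * (3 * k + 4 * k^2) - n^2 * (3 + 3 * k)

/-- The partial derivative of `poly0` in `n`. -/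
def polyN (n k : ℝ) : ℝ :=
  (61 + 306 * k + 565 * k^2 + 456 * k^3 + 136 * k^4) +
    n * (66 + 246 * k + 300 * k^2 + 120 * k^3) + n^2 * (18 + 45 * k + 27 * k^2)

def certDen (n k : ℝ) : ℝ := (3 * k + 1) * (3 * k + 2) * (3 * k + 3) * (n + 2 * k + 2) ^ 2

/-- The rational certificate of the undifferentiated pair; `certA1`, `certA2` and `certB` are its
perturbations in the two directions. -/
noncomputable def cert0 (n k : ℝ) : ℝ := poly0 n k / certDen n k

noncomputable def certA1 (n k : ℝ) : ℝ :=
  (2 * poly0 n k / (n + 2 * k + 2) - polyS n k) / certDen n k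

noncomputable def certA2 (n k : ℝ) : ℝ :=
  (polyM n k - polyS n k / (n + 2 * k + 2) + poly0 n k / (n + 2 * k + 2) ^ 2) / certDen n k

noncomputable def certB (n k : ℝ) : ℝ :=
  (polyN n k + polyS n k / 2 - 3 * poly0 n k / (n + 2 * k + 2)) / certDen n k

/-- The pair equation divided by `kernel n k`, an identity of rational functions. -/
lemma cert0_spec {n k : ℝ} (hn : 0 ≤ n) (hk : 0 ≤ k) :
    ratioK n k - 1 = ratioN n k * cert0 (n + 1) k - cert0 n k := by
  unfold ratioK ratioN cert0 poly0 certDen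
  have e : n + 1 + 2 * k + 2 = n + 2 * k + 3 := by ring
  rw [e]
  field_simp
  ring

/-- The coefficient of `logA n k` in the equation for `pairFA`; `certA2_spec` is the part free of
harmonic sums. -/
lemma certA1_spec {n k : ℝ} (hn : 0 ≤ n) (hk : 0 ≤ k) :
    ratioK n k * (2 * stepA n k) =
    ratioN n k * (2 * (1 / (n + 2 * k + 2) - 1 / (n + k + 1)) * cert0 (n + 1) k + certA1 (n + 1) k) -
      certA1 n k := by
  unfold ratioK ratioN certA1 stepA cert0 poly0 polyS certDen
  have e : n + 1 + 2 * k + 2 = n + 2 * k + 3 := by ring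
  rw [e]
  field_simp
  ring

lemma certA2_spec {n k : ℝ} (hn : 0 ≤ n) (hk : 0 ≤ k) :
    ratioK n k * (stepA n k ^ 2 - 1 / (n + k + 1) ^ 2) =
    ratioN n k * (((1 / (n + 2 * k + 2) - 1 / (n + k + 1)) ^ 2 - 1 / (n + k + 1) ^ 2) *
      cert0 (n + 1) k + (1 / (n + 2 * k + 2) - 1 / (n + k + 1)) * certA1 (n + 1) k +
      certA2 (n + 1) k) - certA2 n k := by
  unfold ratioK ratioN certA1 certA2 stepA cert0 poly0 polyS polyM certDen
  have e : n + 1 + 2 * k + 2 = n + 2 * k + 3 := by ring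
  rw [e]
  field_simp
  ring

lemma certB_spec {n k : ℝ} (hn : 0 ≤ n) (hk : 0 ≤ k) :
    ratioK n k * stepB n k =
    ratioN n k * ((1 / (n + 1) + 2 / (n + k + 1) - 3 / (n + 2 * k + 2)) * cert0 (n + 1) k +
      certB (n + 1) k) - certB n k := by
  unfold ratioK ratioN certB stepB cert0 poly0 polyS polyN certDen
  have e : n + 1 + 2 * k + 2 = n + 2 * k + 3 := by ring
  rw [e]
  field_simp
  ring

/-! ### Estimates for the kernel and the harmonic factors -/

lemma powSum_nonneg (m n : ℕ) : 0 ≤ powSum m n := sum_nonneg fun _ _ => by positivity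

lemma powSum_add_mem (m n p : ℕ) :
    powSum m n ≤ powSum m (n + p) ∧ powSum m (n + p) ≤ powSum m n + p := by
  induction p with
  | zero => simp
  | succ p ih =>
    have h : 1 / (((n + p : ℕ) : ℝ) + 1) ^ m ≤ 1 :=
      div_le_one_of_le₀ (one_le_pow₀ (by linarith [Nat.cast_nonneg (α := ℝ) (n + p)]))
        (by positivity)
    have h0 : 0 ≤ 1 / (((n + p : ℕ) : ℝ) + 1) ^ m := by positivity
    rw [← add_assoc, powSum_succ]
    push_cast at h h0 ⊢
    constructor <;> linarith [ih.1, ih.2]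

lemma powSum_two_le (n : ℕ) : powSum 2 n ≤ 2 - 2 / (2 * (n : ℝ) + 1) := by
  induction n with
  | zero => norm_num [powSum]
  | succ n ih =>
    rw [powSum_succ]
    -- The right side equals 1/((n+1)² - 1/4), so the bound telescopes.
    have key : 1 / ((n : ℝ) + 1) ^ 2 ≤ 2 / (2 * (n : ℝ) + 1) - 2 / (2 * ((n : ℝ) + 1) + 1) := by
      rw [div_sub_div _ _ (by positivity) (by positivity),
        div_le_div_iff₀ (by positivity) (by positivity)]
      nlinarith
    push_cast
    linarith

/-- The sums pair off into blocks of at most k+1 consecutive terms, each in [0,1], which makes the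
bound uniform in n. -/
lemma abs_logA_le (n k : ℕ) : |logA n k| ≤ k + 1 := by
  have h1 := powSum_add_mem 1 (n + k) (k + 1)
  have h2 := powSum_add_mem 1 k k
  have e1 : n + k + (k + 1) = n + 2 * k + 1 := by ring
  have e2 : k + k = 2 * k := by ring
  rw [e1] at h1
  rw [e2] at h2
  push_cast at h1
  rw [logA, abs_le]
  constructor <;> linarith [h1.1, h1.2, h2.1, h2.2]

lemma abs_logB_le (n k : ℕ) : |logB n k| ≤ 4 * k + 3 := by
  have h1 := powSum_add_mem 1 (n + k) (k + 1)
  have h2 := powSum_add_mem 1 k k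
  have h3 := powSum_add_mem 1 n (2 * k + 1)
  have e1 : n + k + (k + 1) = n + 2 * k + 1 := by ring
  have e2 : k + k = 2 * k := by ring
  rw [e1] at h1
  rw [e2] at h2
  rw [← add_assoc] at h3
  push_cast at h1 h3
  rw [logB, abs_le]
  constructor <;> linarith [h1.1, h1.2, h2.1, h2.2, h3.1, h3.2]

/-- A crude bound: for fixed n the quotient tends to -1/27 in k. -/
lemma abs_ratioK_le (n k : ℕ) : |ratioK n k| ≤ 1 / 4 := by
  have hn : (0 : ℝ) ≤ n := n.cast_nonneg
  have hk : (0 : ℝ) ≤ k := k.cast_nonneg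
  rw [ratioK, neg_div, abs_neg, abs_of_nonneg (by positivity), div_le_div_iff₀ (by positivity)
    (by norm_num)]
  have h1 : ((k : ℝ) + 1) * (2 * k + 1) * 4 ≤ 3 * ((3 * k + 1) * (3 * k + 2)) := by nlinarith
  calc ((k : ℝ) + 1) ^ 2 * (2 * k + 1) ^ 2 * (2 * k + 2) ^ 2 * ((n : ℝ) + k + 1) * 4
      = (((k : ℝ) + 1) * (2 * k + 1) * 4) * (k + 1) * (2 * k + 2) ^ 2 *
          ((2 * k + 1) * ((n : ℝ) + k + 1)) := by ring
    _ ≤ (3 * ((3 * (k : ℝ) + 1) * (3 * k + 2))) * (k + 1) * ((n : ℝ) + 2 * k + 2) ^ 2 *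
          (((n : ℝ) + 2 * k + 3) * (n + 2 * k + 3)) := by gcongr <;> linarith
    _ = _ := by ring

lemma abs_kernel_le (n k : ℕ) : |kernel n k| ≤ (1 / 4) ^ k / ((n : ℝ) + 1) ^ 2 := by
  induction k with
  | zero => rw [kernel_zero_right, abs_of_nonneg (by positivity)]; simp
  | succ k ih =>
    rw [kernel_succ_right, abs_mul]
    calc _ ≤ (1 / 4) ^ k / ((n : ℝ) + 1) ^ 2 * (1 / 4) := by
          gcongr; exact abs_ratioK_le n k
      _ = _ := by ring

/-! ### The two pairs and their summation -/

/-- The pair `pairFB`, `pairGB` sums to a multiple of `ζ(3)`. -/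
noncomputable def pairFB (n k : ℕ) : ℝ := kernel n k * logB n k

noncomputable def pairGB (n k : ℕ) : ℝ := kernel n k * (logB n k * cert0 n k + certB n k)

/-- The pair `pairFA`, `pairGA` sums to a multiple of `ζ(4)`. -/
noncomputable def pairFA (n k : ℕ) : ℝ := kernel n k * (logA n k ^ 2 - powSum 2 (n + k))

noncomputable def pairGA (n k : ℕ) : ℝ :=
  kernel n k * ((logA n k ^ 2 - powSum 2 (n + k)) * cert0 n k + logA n k * certA1 n k + certA2 n k)

lemma pairB_spec (n k : ℕ) :
    pairFB n (k + 1) - pairFB n k = pairGB (n + 1) k - pairGB n k := by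
  have hn : (0 : ℝ) ≤ n := n.cast_nonneg
  have hk : (0 : ℝ) ≤ k := k.cast_nonneg
  simp only [pairFB, pairGB, kernel_succ_right, kernel_succ_left, logB_succ_right, logB_succ_left]
  push_cast
  linear_combination kernel n k * (logB n k * cert0_spec hn hk + certB_spec hn hk)

lemma pairA_spec (n k : ℕ) :
    pairFA n (k + 1) - pairFA n k = pairGA (n + 1) k - pairGA n k := by
  have hn : (0 : ℝ) ≤ n := n.cast_nonneg
  have hk : (0 : ℝ) ≤ k := k.cast_nonneg
  have e4 : n + (k + 1) = n + k + 1 := by ring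
  have e5 : n + 1 + k = n + k + 1 := by ring
  simp only [pairFA, pairGA, kernel_succ_right, kernel_succ_left, logA_succ_right, logA_succ_left,
    e4, e5, powSum_succ]
  push_cast
  linear_combination kernel n k * ((logA n k ^ 2 - powSum 2 (n + k)) * cert0_spec hn hk +
    logA n k * certA1_spec hn hk + certA2_spec hn hk)

/-- Summation by a Wilf–Zeilberger pair: the boundary series in `k` converges to the boundary
series in `n`. -/
lemma tendsto_sum_of_pair {F G : ℕ → ℕ → ℝ}
    (h : ∀ n k, F n (k + 1) - F n k = G (n + 1) k - G n k)
    (hF : ∀ k, Summable fun n => F n k) (hG : ∀ k, Tendsto (fun n => G n k) atTop (𝓝 0))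
    (hlim : Tendsto (fun k => ∑' n, F n k) atTop (𝓝 0)) :
    Tendsto (fun K => ∑ k ∈ range K, G 0 k) atTop (𝓝 (∑' n, F n 0)) := by
  have step : ∀ k, G 0 k = (∑' n, F n k) - ∑' n, F n (k + 1) := by
    intro k
    -- The partial sums over `n < N` telescope to `G N k - G 0 k`, and `G N k` vanishes in the
    -- limit.
    have h1 := ((hF (k + 1)).sub (hF k)).hasSum.tendsto_sum_nat
    simp only [h, sum_range_sub (fun n => G n k)] at h1
    have h2 := tendsto_nhds_unique h1 ((hG k).sub_const (G 0 k))
    have h3 := (hF (k + 1)).tsum_sub (hF k)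
    simp only [h] at h3
    linarith
  have : ∀ K, ∑ k ∈ range K, G 0 k = (∑' n, F n 0) - ∑' n, F n K := fun K => by
    simp only [step]
    exact sum_range_sub' (fun k => ∑' n, F n k) K
  simp only [this]
  simpa using hlim.const_sub (∑' n, F n 0)

lemma poly0_bounds {n k : ℝ} (hn : 0 ≤ n) (hk : 0 ≤ k) :
    0 ≤ poly0 n k ∧ poly0 n k ≤ 1000 * ((n + 1) ^ 3 * (k + 1) ^ 5) := by
  refine ⟨by unfold poly0; positivity, sub_nonneg.1 ?_⟩
  unfold poly0
  -- All coefficients of the expanded difference are nonnegative.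
  ring_nf
  positivity

lemma polyS_bounds {n k : ℝ} (hn : 0 ≤ n) (hk : 0 ≤ k) :
    0 ≤ polyS n k ∧ polyS n k ≤ 1000 * ((n + 1) ^ 3 * (k + 1) ^ 5) := by
  refine ⟨by unfold polyS; positivity, sub_nonneg.1 ?_⟩
  unfold polyS
  ring_nf
  positivity

lemma polyN_bounds {n k : ℝ} (hn : 0 ≤ n) (hk : 0 ≤ k) :
    0 ≤ polyN n k ∧ polyN n k ≤ 1000 * ((n + 1) ^ 3 * (k + 1) ^ 5) := by
  refine ⟨by unfold polyN; positivity, sub_nonneg.1 ?_⟩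
  unfold polyN
  ring_nf
  positivity

lemma abs_polyM_le {n k : ℝ} (hn : 0 ≤ n) (hk : 0 ≤ k) :
    |polyM n k| ≤ 1000 * ((n + 1) ^ 3 * (k + 1) ^ 5) := by
  rw [abs_le, ← sub_nonneg, ← sub_nonneg (b := polyM n k)]
  unfold polyM
  constructor
  · ring_nf
    positivity
  · ring_nf
    positivity

/-- A Wilf–Zeilberger pair with summable geometric-type majorants identifies the two boundary
series. -/
lemma hasSum_of_pair {F G : ℕ → ℕ → ℝ} {c : ℕ → ℝ}
    (h : ∀ n k, F n (k + 1) - F n k = G (n + 1) k - G n k)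
    (hF : ∀ n k, |F n k| ≤ c k * (1 / ((n : ℝ) + 1) ^ 2))
    (hG : ∀ n k, |G n k| ≤ c k * (1 / ((n : ℝ) + 1))) (hc : Summable c) :
    (Summable fun n => F n 0) ∧ HasSum (fun k => G 0 k) (∑' n, F n 0) := by
  have hsq : Summable fun n : ℕ => 1 / ((n : ℝ) + 1) ^ 2 := by
    have := (summable_nat_add_iff 1).2 (Real.summable_one_div_nat_pow.2 one_lt_two)
    simpa using this
  have hFs : ∀ k, Summable fun n => F n k := fun k =>
    Summable.of_norm_bounded (hsq.mul_left (c k)) fun n => hF n k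
  refine ⟨hFs 0, ?_⟩
  have hGs : Summable fun k => G 0 k :=
    Summable.of_norm_bounded hc fun k => by simpa using hG 0 k
  have hlim : Tendsto (fun k => ∑' n, F n k) atTop (𝓝 0) := by
    have h0 := hc.tendsto_atTop_zero.mul_const (∑' n : ℕ, 1 / ((n : ℝ) + 1) ^ 2)
    rw [zero_mul] at h0
    refine squeeze_zero_norm (fun k => ?_) h0
    exact tsum_of_norm_bounded (hsq.hasSum.mul_left (c k)) fun n => hF n k
  have hG0 : ∀ k, Tendsto (fun n => G n k) atTop (𝓝 0) := fun k => by
    have h0 := (tendsto_one_div_add_atTop_nhds_zero_nat (𝕜 := ℝ)).const_mul (c k)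
    rw [mul_zero] at h0
    exact squeeze_zero_norm (fun n => hG n k) h0
  have := tendsto_nhds_unique hGs.hasSum.tendsto_sum_nat (tendsto_sum_of_pair h hFs hG0 hlim)
  exact this ▸ hGs.hasSum

/-! ### Majorants and convergence -/

lemma sq_le_certDen {n k : ℝ} (hn : 0 ≤ n) (hk : 0 ≤ k) : (n + 1) ^ 2 ≤ certDen n k := by
  unfold certDen
  calc (n + 1) ^ 2 = 1 * 1 * 1 * (n + 1) ^ 2 := by ring
    _ ≤ _ := by gcongr <;> linarith

lemma abs_div_certDen_le {n k x c : ℝ} (hn : 0 ≤ n) (hk : 0 ≤ k) (hc : 0 ≤ c)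
    (hx : |x| ≤ c * ((n + 1) ^ 3 * (k + 1) ^ 5)) :
    |x / certDen n k| ≤ c * ((n + 1) * (k + 1) ^ 5) := by
  have hd := sq_le_certDen hn hk
  have h0 : 0 < certDen n k := lt_of_lt_of_le (by positivity) hd
  rw [abs_div, abs_of_pos h0, div_le_iff₀ h0]
  calc |x| ≤ c * ((n + 1) * (k + 1) ^ 5) * (n + 1) ^ 2 := hx.trans_eq (by ring)
    _ ≤ _ := by gcongr

lemma abs_cert_le {n k : ℝ} (hn : 0 ≤ n) (hk : 0 ≤ k) :
    |cert0 n k| ≤ 5000 * ((n + 1) * (k + 1) ^ 5) ∧ |certA1 n k| ≤ 5000 * ((n + 1) * (k + 1) ^ 5) ∧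
    |certA2 n k| ≤ 5000 * ((n + 1) * (k + 1) ^ 5) ∧
    |certB n k| ≤ 5000 * ((n + 1) * (k + 1) ^ 5) := by
  obtain ⟨a0, a1⟩ := poly0_bounds hn hk
  obtain ⟨b0, b1⟩ := polyS_bounds hn hk
  obtain ⟨c0, c1⟩ := polyN_bounds hn hk
  obtain ⟨d0, d1⟩ := abs_le.1 (abs_polyM_le hn hk)
  have hw : (1 : ℝ) ≤ n + 2 * k + 2 := by linarith
  have e1 : 0 ≤ poly0 n k / (n + 2 * k + 2) := by positivity
  have e2 : poly0 n k / (n + 2 * k + 2) ≤ poly0 n k := div_le_self a0 hw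
  have e3 : 0 ≤ poly0 n k / (n + 2 * k + 2) ^ 2 := by positivity
  have e4 : poly0 n k / (n + 2 * k + 2) ^ 2 ≤ poly0 n k := div_le_self a0 (one_le_pow₀ hw)
  have e5 : 0 ≤ polyS n k / (n + 2 * k + 2) := by positivity
  have e6 : polyS n k / (n + 2 * k + 2) ≤ polyS n k := div_le_self b0 hw
  refine ⟨?_, ?_, ?_, ?_⟩ <;> refine abs_div_certDen_le hn hk (by norm_num) (abs_le.2 ?_)
  · constructor <;> linarith
  · rw [mul_div_assoc]
    constructor <;> linarith
  · constructor <;> linarith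
  · rw [mul_div_assoc]
    constructor <;> linarith

/-- A common majorant for both pairs. -/
noncomputable def majorant (k : ℕ) : ℝ := 40000 * (((k : ℝ) + 1) ^ 7 * (1 / 4) ^ k)

lemma summable_majorant : Summable majorant := by
  have h := (summable_nat_add_iff 1).2 (summable_pow_mul_geometric_of_norm_lt_one 7
    (r := (1 / 4 : ℝ)) (by norm_num))
  -- The 4 undoes the shift of the exponent of 1/4.
  refine (h.mul_left (4 * 40000)).congr fun k => ?_
  rw [majorant]
  push_cast
  ring

lemma abs_kernel_mul_le {n k : ℕ} {x : ℝ} (hx : |x| ≤ 40000 * ((k : ℝ) + 1) ^ 7) :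
    |kernel n k * x| ≤ majorant k * (1 / ((n : ℝ) + 1) ^ 2) := by
  rw [abs_mul, majorant]
  calc _ ≤ (1 / 4) ^ k / ((n : ℝ) + 1) ^ 2 * (40000 * ((k : ℝ) + 1) ^ 7) := by
        gcongr
        exact abs_kernel_le n k
    _ = _ := by ring

lemma abs_kernel_mul_le' {n k : ℕ} {x : ℝ}
    (hx : |x| ≤ 40000 * ((k : ℝ) + 1) ^ 7 * ((n : ℝ) + 1)) :
    |kernel n k * x| ≤ majorant k * (1 / ((n : ℝ) + 1)) := by
  rw [abs_mul, majorant]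
  calc _ ≤ (1 / 4) ^ k / ((n : ℝ) + 1) ^ 2 * (40000 * ((k : ℝ) + 1) ^ 7 * ((n : ℝ) + 1)) := by
        gcongr
        exact abs_kernel_le n k
    _ = _ := by field_simp

lemma abs_sq_sub_le (n k : ℕ) : |logA n k ^ 2 - powSum 2 (n + k)| ≤ 3 * ((k : ℝ) + 1) ^ 2 := by
  have h1 := abs_logA_le n k
  have h2 : logA n k ^ 2 ≤ ((k : ℝ) + 1) ^ 2 := sq_le_sq' (abs_le.1 h1).1 (abs_le.1 h1).2
  have h3 := powSum_nonneg 2 (n + k)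
  have h4 : powSum 2 (n + k) ≤ 2 := (powSum_two_le (n + k)).trans (sub_le_self _ (by positivity))
  have h5 : (1 : ℝ) ≤ ((k : ℝ) + 1) ^ 2 := one_le_pow₀ (by linarith [Nat.cast_nonneg (α := ℝ) k])
  rw [abs_le]
  constructor <;> linarith [sq_nonneg (logA n k)]

lemma pow_le_pow_seven (k : ℕ) {m : ℕ} (hm : m ≤ 7) : ((k : ℝ) + 1) ^ m ≤ ((k : ℝ) + 1) ^ 7 :=
  pow_le_pow_right₀ (by linarith [Nat.cast_nonneg (α := ℝ) k]) hm

lemma pairB_hasSum : (Summable fun n => pairFB n 0) ∧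
    HasSum (fun k => pairGB 0 k) (∑' n, pairFB n 0) := by
  refine hasSum_of_pair pairB_spec (c := majorant) (fun n k => ?_) (fun n k => ?_) summable_majorant
  · refine abs_kernel_mul_le ((abs_logB_le n k).trans ?_)
    have := pow_le_pow_seven k (m := 1) (by norm_num)
    linarith [Nat.cast_nonneg (α := ℝ) k]
  · have hn : (0 : ℝ) ≤ n := n.cast_nonneg
    have hk : (0 : ℝ) ≤ k := k.cast_nonneg
    obtain ⟨h0, -, -, h1⟩ := abs_cert_le hn hk
    refine abs_kernel_mul_le' ?_
    have h6 := pow_le_pow_seven k (m := 6) (by norm_num)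
    have h5 := pow_le_pow_seven k (m := 5) (by norm_num)
    calc _ ≤ |logB n k| * |cert0 n k| + |certB n k| := by
          rw [← abs_mul]; exact abs_add_le _ _
      _ ≤ (4 * ((k : ℝ) + 1)) * (5000 * ((n + 1) * (k + 1) ^ 5)) +
          5000 * ((n + 1) * (k + 1) ^ 5) := by
        gcongr
        linarith [abs_logB_le n k]
      _ = (20000 * ((k : ℝ) + 1) ^ 6 + 5000 * (k + 1) ^ 5) * (n + 1) := by ring
      _ ≤ _ := by
        have : (0 : ℝ) ≤ ((k : ℝ) + 1) ^ 7 := by positivity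
        gcongr
        linarith

lemma pairA_hasSum : (Summable fun n => pairFA n 0) ∧
    HasSum (fun k => pairGA 0 k) (∑' n, pairFA n 0) := by
  refine hasSum_of_pair pairA_spec (c := majorant) (fun n k => ?_) (fun n k => ?_) summable_majorant
  · refine abs_kernel_mul_le ((abs_sq_sub_le n k).trans ?_)
    have := pow_le_pow_seven k (m := 2) (by norm_num)
    have : (0 : ℝ) ≤ ((k : ℝ) + 1) ^ 7 := by positivity
    linarith
  · have hn : (0 : ℝ) ≤ n := n.cast_nonneg
    have hk : (0 : ℝ) ≤ k := k.cast_nonneg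
    obtain ⟨h0, h1, h2, -⟩ := abs_cert_le hn hk
    refine abs_kernel_mul_le' ?_
    have h6 := pow_le_pow_seven k (m := 6) (by norm_num)
    have h5 := pow_le_pow_seven k (m := 5) (by norm_num)
    calc _ ≤ |logA n k ^ 2 - powSum 2 (n + k)| * |cert0 n k| + |logA n k| * |certA1 n k| +
            |certA2 n k| := by
          rw [← abs_mul, ← abs_mul]; exact abs_add_three _ _ _
      _ ≤ (3 * ((k : ℝ) + 1) ^ 2) * (5000 * ((n + 1) * (k + 1) ^ 5)) +
          ((k : ℝ) + 1) * (5000 * ((n + 1) * (k + 1) ^ 5)) + 5000 * ((n + 1) * (k + 1) ^ 5) := by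
        gcongr
        · exact abs_sq_sub_le n k
        · exact abs_logA_le n k
      _ = (15000 * ((k : ℝ) + 1) ^ 7 + 5000 * (k + 1) ^ 6 + 5000 * (k + 1) ^ 5) * (n + 1) := by ring
      _ ≤ _ := by
        have : (0 : ℝ) ≤ ((k : ℝ) + 1) ^ 7 := by positivity
        gcongr
        linarith

/-! ### Boundary series at k = 0 -/

lemma tendsto_powSum {m : ℕ} {s : ℝ} (hm : m ≠ 0)
    (h : HasSum (fun n : ℕ => 1 / (n : ℝ) ^ m) s) : Tendsto (powSum m) atTop (𝓝 s) := by
  have := ((hasSum_nat_add_iff' 1).2 h).tendsto_sum_nat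
  change Tendsto (fun n => ∑ j ∈ range n, 1 / ((j : ℝ) + 1) ^ m) atTop (𝓝 s)
  simpa [hm] using this

lemma tsum_pairFB : ((∑' n, pairFB n 0 : ℝ) : ℂ) = -3 * riemannZeta 3 := by
  -- Here `logB n 0` is -3/(n+1).
  have h : ∀ n, pairFB n 0 = -3 * (1 / ((n : ℝ) + 1) ^ 3) := fun n => by
    simp only [pairFB, kernel_zero_right, logB, mul_zero, add_zero, powSum_succ, powSum_zero]
    field_simp
    ring
  have hz := zeta_eq_tsum_one_div_nat_add_one_cpow (s := 3) (by norm_num)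
  simp only [h, tsum_mul_left]
  rw [hz]
  push_cast
  congr 2
  funext n
  norm_cast

/-- As `logA n 0` is 1/(n+1), only 1/(n+1)⁴ minus a double sum over i < j of 1/(i²j²) remains, and
symmetry evaluates the latter. -/
lemma tsum_pairFA : ∑' n, pairFA n 0 = Real.pi ^ 4 / 360 := by
  have hsum : ∀ N, ∑ n ∈ range N, pairFA n 0 = 3 / 2 * powSum 4 N - powSum 2 N ^ 2 / 2 := by
    intro N
    induction N with
    | zero => simp [powSum_zero]
    | succ N ih =>
      rw [sum_range_succ, ih]
      simp only [pairFA, kernel_zero_right, logA, mul_zero, add_zero, powSum_succ, powSum_zero]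
      field_simp
      ring
  have h1 := pairA_hasSum.1.hasSum.tendsto_sum_nat
  simp only [hsum] at h1
  have h2 := ((tendsto_powSum (by norm_num) hasSum_zeta_four).const_mul (3 / 2)).sub
    (((tendsto_powSum (by norm_num) hasSum_zeta_two).pow 2).div_const 2)
  rw [tendsto_nhds_unique h1 h2]
  ring

/-! ### Boundary series at n = 0 -/

lemma harmonic_eq_powSum (n : ℕ) : (harmonic n : ℝ) = powSum 1 n := by
  simp [harmonic, powSum]

lemma genHarmonic_eq_powSum (m n : ℕ) : (genHarmonic m n : ℝ) = powSum m n := by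
  induction n with
  | zero => simp [genHarmonic, powSum_zero]
  | succ n ih =>
    rw [genHarmonic, sum_Icc_succ_top (by omega), ← genHarmonic, powSum_succ, ← ih]
    push_cast
    rfl

lemma choose_mul_choose (k : ℕ) : ((2 * k).choose k : ℝ) * ((3 * k).choose k : ℝ) =
    (3 * k).factorial / (k.factorial : ℝ) ^ 3 := by
  have h2 : (2 * k).choose k = (k + k).choose k := by rw [two_mul]
  have h3 : (3 * k).choose k = (k + 2 * k).choose k := by congr 1; ring
  have e3 : k + 2 * k = 3 * k := by ring
  rw [h2, h3, Nat.cast_add_choose, Nat.cast_add_choose, ← two_mul, e3]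
  have := Nat.factorial_ne_zero k
  have := Nat.factorial_ne_zero (2 * k)
  field_simp

lemma kernel_zero_left (k : ℕ) : kernel 0 k =
    (-1) ^ k * (k.factorial : ℝ) ^ 3 / ((3 * k).factorial * (2 * (k : ℝ) + 1) ^ 2) := by
  have := Nat.factorial_ne_zero (2 * k)
  have := Nat.factorial_ne_zero (3 * k)
  simp only [kernel, zero_add, Nat.factorial_succ (2 * k), Nat.factorial_zero]
  push_cast
  field_simp

lemma prefactor_succ (k : ℕ) :
    (-1 : ℝ) ^ (k + 1) / (((k + 1 : ℕ) : ℝ) ^ 2 * ((2 * (k + 1)).choose (k + 1) : ℝ) *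
      ((3 * (k + 1)).choose (k + 1) : ℝ)) =
    -(kernel 0 k * ((2 * (k : ℝ) + 1) ^ 2 * (k + 1) / ((3 * k + 1) * (3 * k + 2) * (3 * k + 3)))) := by
  have e2 : 3 * (k + 1) = 3 * k + 1 + 1 + 1 := by ring
  rw [mul_assoc, choose_mul_choose, kernel_zero_left, e2]
  have := Nat.factorial_ne_zero k
  have := Nat.factorial_ne_zero (3 * k)
  simp only [Nat.factorial_succ k, Nat.factorial_succ (3 * k), Nat.factorial_succ (3 * k + 1),
    Nat.factorial_succ (3 * k + 1 + 1)]
  push_cast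
  field_simp
  ring

/-- At n = 0, `logB` is -(2H_{2k+1} - H_k) - 1/(2k+1). -/
lemma pairGB_zero_left (k : ℕ) :
    (-1 : ℝ) ^ (k + 1) / (((k + 1 : ℕ) : ℝ) ^ 2 * ((2 * (k + 1)).choose (k + 1) : ℝ) *
      ((3 * (k + 1)).choose (k + 1) : ℝ)) *
      ((7 * ((k + 1 : ℕ) : ℝ) - 2) / (2 * ((k + 1 : ℕ) : ℝ) - 1) *
        (2 * (harmonic (2 * (k + 1) - 1) : ℝ) - (harmonic (k + 1 - 1) : ℝ)) +
          1 / ((k + 1 : ℕ) : ℝ)) = pairGB 0 k / 2 := by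
  have e1 : 2 * (k + 1) - 1 = 2 * k + 1 := by omega
  have e2 : 2 * ((k : ℝ) + 1) - 1 = 2 * k + 1 := by ring
  rw [prefactor_succ, e1, Nat.add_sub_cancel, harmonic_eq_powSum, harmonic_eq_powSum]
  simp only [pairGB, logB, zero_add, powSum_zero, powSum_succ, cert0, certB, certDen, poly0, polyN,
    polyS]
  push_cast
  rw [e2]
  field_simp
  ring

/-- At n = 0, `logA` collapses to 1/(2k+1), so the only harmonic sum left is `powSum 2 k`. -/
lemma pairGA_zero_left (k : ℕ) :
    (-1 : ℝ) ^ (k + 1) / (((k + 1 : ℕ) : ℝ) ^ 2 * ((2 * (k + 1)).choose (k + 1) : ℝ) *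
      ((3 * (k + 1)).choose (k + 1) : ℝ)) *
      ((7 * ((k + 1 : ℕ) : ℝ) - 2) / (2 * ((k + 1 : ℕ) : ℝ) - 1) *
        (genHarmonic 2 (k + 1 - 1) : ℝ) - 3 / (4 * ((k + 1 : ℕ) : ℝ) ^ 2)) = pairGA 0 k / 2 := by
  have e2 : 2 * ((k : ℝ) + 1) - 1 = 2 * k + 1 := by ring
  rw [prefactor_succ, Nat.add_sub_cancel, genHarmonic_eq_powSum]
  simp only [pairGA, logA, zero_add, powSum_succ, cert0, certA1, certA2, certDen, poly0, polyM,
    polyS]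
  push_cast
  rw [e2]
  field_simp
  ring

theorem theorem1p7 :
    HasSum (fun k : ℕ+ =>
      (((-1 : ℝ) ^ (k : ℕ) /
          ((k : ℝ) ^ 2 * (Nat.choose (2 * (k : ℕ)) (k : ℕ) : ℝ) *
            (Nat.choose (3 * (k : ℕ)) (k : ℕ) : ℝ)) *
        ((7 * (k : ℝ) - 2) / (2 * (k : ℝ) - 1) *
            (2 * (harmonic (2 * (k : ℕ) - 1) : ℝ) - (harmonic ((k : ℕ) - 1) : ℝ)) +
          1 / (k : ℝ)) : ℝ) : ℂ))
      (-(3 / 2) * riemannZeta 3) ∧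
    HasSum (fun k : ℕ+ =>
      (-1 : ℝ) ^ (k : ℕ) /
          ((k : ℝ) ^ 2 * (Nat.choose (2 * (k : ℕ)) (k : ℕ) : ℝ) *
            (Nat.choose (3 * (k : ℕ)) (k : ℕ) : ℝ)) *
        ((7 * (k : ℝ) - 2) / (2 * (k : ℝ) - 1) * (genHarmonic 2 ((k : ℕ) - 1) : ℝ) -
          3 / (4 * (k : ℝ) ^ 2)))
      (Real.pi ^ 4 / 720) := by
  constructor
  · rw [← Equiv.pnatEquivNat.symm.hasSum_iff]
    have h := (Complex.hasSum_ofReal.2 pairB_hasSum.2).div_const 2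
    rw [tsum_pairFB] at h
    rw [show -(3 / 2) * riemannZeta 3 = -3 * riemannZeta 3 / 2 by ring]
    refine Eq.mpr (congrArg (HasSum · _ _) (funext fun k => ?_)) h
    rw [← Complex.ofReal_ofNat, ← Complex.ofReal_div, ← pairGB_zero_left]
    rfl
  · rw [← Equiv.pnatEquivNat.symm.hasSum_iff]
    have h := pairA_hasSum.2.div_const 2
    rw [tsum_pairFA] at h
    rw [show Real.pi ^ 4 / 720 = Real.pi ^ 4 / 360 / 2 by ring]
    refine Eq.mpr (congrArg (HasSum · _ _) (funext fun k => ?_)) h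
    rw [← pairGA_zero_left]
    rfl
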